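/- Let $r,s,t,u$ be integers with $ru-st=\pm1$ and $rstu\neq 0$, and let $$G=\langle a_1,b_1,a_2 \mid a_1b_1a_1^{-1}=b_1^{-1},\ a_2^2=a_1^{2r}b_1^{s},\ a_2a_1^{2t}b_1^{u}a_2^{-1}=b_1^{-u}a_1^{-2t}\rangle$$ (the fundamental group of the torus semi-bundle, or sapphire, $K(r,s,t,u)$). For a homomorphism $\eta\colon G\to\operatorname{Aut}(\mathbb{Z})=\{1,-1\}$ let $\mathbb{Z}_\eta$ denote the $G$-module with underlying abelian group $\mathbb{Z}$ on which $g\in G$ acts as multiplication by $\eta(g)$. Write $\mathbb{Z}_n=\mathbb{Z}/n\mathbb{Z}$ for every nonzero integer $n$. Then there are the following isomorphisms of abelian groups. (1) If $\eta_1(a_1)=\eta_1(b_1)=1$ and $\eta_1(a_2)=-1$, then $H^1(G;\mathbb{Z}_{\eta_1})\cong\mathbb{Z}_2$, and $H^2(G;\mathbb{Z}_{\eta_1})\cong\mathbb{Z}_{2r}\oplus\mathbb{Z}_2$ if $s$ is even, $H^2(G;\mathbb{Z}_{\eta_1})\cong\mathbb{Z}_{4r}$ if $s$ is odd. (2) If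 $\eta_2(a_1)=-1$ and $\eta_2(b_1)=\eta_2(a_2)=1$, then $H^1(G;\mathbb{Z}_{\eta_2})\cong\mathbb{Z}_2$, and $H^2(G;\mathbb{Z}_{\eta_2})\cong\mathbb{Z}_{2u}\oplus\mathbb{Z}_2$ if $s$ is even, $H^2(G;\mathbb{Z}_{\eta_2})\cong\mathbb{Z}_{4u}$ if $s$ is odd. (3) If $\eta_3(a_1)=\eta_3(a_2)=-1$ and $\eta_3(b_1)=1$, then $H^1(G;\mathbb{Z}_{\eta_3})\cong\mathbb{Z}\oplus\mathbb{Z}_2$ and $H^2(G;\mathbb{Z}_{\eta_3})\cong\mathbb{Z}\oplus\mathbb{Z}_s$. -/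

import Mathlib

/-- The three generators `a₁`, `b₁`, `a₂` of the fundamental group of a sapphire. -/
inductive SapphireGen : Type
  | a1
  | b1
  | a2

namespace Sapphire

/-- The relators of the fundamental group of the sapphire `K(r,s,t,u)`: every relation
`p = q` is written as the relator `p * q⁻¹`. The relations are, in this order,
`a₁ b₁ a₁⁻¹ = b₁⁻¹`, `a₂² = a₁^(2r) b₁^s` and
`a₂ a₁^(2t) b₁^u a₂⁻¹ = b₁^(-u) a₁^(-2t)`. -/
def rels (r s t u : ℤ) : Set (FreeGroup SapphireGen) :=
  let a₁ := FreeGroup.of SapphireGen.a1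
  let b₁ := FreeGroup.of SapphireGen.b1
  let a₂ := FreeGroup.of SapphireGen.a2
  { a₁ * b₁ * a₁⁻¹ * (b₁⁻¹)⁻¹,
    a₂ ^ 2 * (a₁ ^ (2 * r) * b₁ ^ s)⁻¹,
    a₂ * a₁ ^ (2 * t) * b₁ ^ u * a₂⁻¹ * (b₁ ^ (-u) * a₁ ^ (-2 * t))⁻¹ }

/-- The fundamental group of the sapphire `K(r,s,t,u)`. -/
abbrev G (r s t u : ℤ) : Type := PresentedGroup (rels r s t u)

/-- The generator `a₁` of the group. -/
def a₁ (r s t u : ℤ) : G r s t u := PresentedGroup.of SapphireGen.a1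

/-- The generator `b₁` of the group. -/
def b₁ (r s t u : ℤ) : G r s t u := PresentedGroup.of SapphireGen.b1

/-- The generator `a₂` of the group. -/
def a₂ (r s t u : ℤ) : G r s t u := PresentedGroup.of SapphireGen.a2

/-- The signs assigned to the generators: `a₁ ↦ ε₁`, `b₁ ↦ 1`, `a₂ ↦ ε₂`. -/
def signs (ε₁ ε₂ : ℤˣ) : SapphireGen → ℤˣ
  | SapphireGen.a1 => ε₁
  | SapphireGen.b1 => 1
  | SapphireGen.a2 => ε₂

theorem signs_rels (r s t u : ℤ) (ε₁ ε₂ : ℤˣ) :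
    ∀ w ∈ rels r s t u, FreeGroup.lift (signs ε₁ ε₂) w = 1 := by
  have key : ∀ (ε : ℤˣ) (n : ℤ), ε ^ (2 * n) = 1 := by
    intro ε n
    rw [zpow_mul]
    rcases Int.units_eq_one_or ε with h | h <;> simp [h]
  intro w hw
  simp only [rels, Set.mem_insert_iff, Set.mem_singleton_iff] at hw
  rcases hw with rfl | rfl | rfl
  · simp [signs]
  · simp [signs, key, Int.units_sq]
  · simp [signs, key]

/-- The homomorphism `η : G → Aut(ℤ) = {1, -1}` with `η(a₁) = ε₁`, `η(b₁) = 1`,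
`η(a₂) = ε₂`. -/
def eta (r s t u : ℤ) (ε₁ ε₂ : ℤˣ) : G r s t u →* ℤˣ :=
  PresentedGroup.toGroup (f := signs ε₁ ε₂) (signs_rels r s t u ε₁ ε₂)

theorem eta_a₁ (r s t u : ℤ) (ε₁ ε₂ : ℤˣ) : eta r s t u ε₁ ε₂ (a₁ r s t u) = ε₁ :=
  PresentedGroup.toGroup.of (signs_rels r s t u ε₁ ε₂)

theorem eta_b₁ (r s t u : ℤ) (ε₁ ε₂ : ℤˣ) : eta r s t u ε₁ ε₂ (b₁ r s t u) = 1 :=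
  PresentedGroup.toGroup.of (signs_rels r s t u ε₁ ε₂)

theorem eta_a₂ (r s t u : ℤ) (ε₁ ε₂ : ℤˣ) : eta r s t u ε₁ ε₂ (a₂ r s t u) = ε₂ :=
  PresentedGroup.toGroup.of (signs_rels r s t u ε₁ ε₂)

end Sapphire

/-- The representation of `Γ` on the abelian group `ℤ` in which `g` acts as multiplication
by the sign `η g`. -/
def twistedIntRepresentation {Γ : Type} [Group Γ] (η : Γ →* ℤˣ) : Representation ℤ Γ ℤ where
  toFun g := LinearMap.mulLeft ℤ ((η g : ℤˣ) : ℤ)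
  map_one' := by
    ext
    simp
  map_mul' g h := by
    ext
    simp

/-- The `Γ`-module `ℤ_η`: the abelian group `ℤ` with `Γ` acting through `η`. -/
abbrev twistedInt {Γ : Type} [Group Γ] (η : Γ →* ℤˣ) : Rep ℤ Γ :=
  Rep.of (twistedIntRepresentation η)

/-!
The computation takes place in the presentation complex. For a presented group and a 2-cocycle `f`
with values in a module `A`, lift the generators to the extension of the group by `A` that `f`
determines and evaluate the relators there; this gives one element of `A` for each relator. If
the lifts change, these elements change by Fox derivatives of the relators, and by the universal
property of the presentation the extension splits if and only if the elements are Fox derivatives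
(`mem_coboundaries₂_iff_relatorHom`). Hence `H²` embeds into the cokernel of the Fox matrix,
and the image has to be found.

For the group of a sapphire and coefficients `ℤ_η`, the Fox matrix is `foxTriple`, and the image is
bounded from above by an identity among the relations, `relatorHom_rel₃`. The group is
an amalgam of two Klein bottle groups over the fibre group `ℤ²`; the first relator and the third
relator each determine the commutator of a basis of `ℤ²` in the extension, and the two bases differ
by a matrix of determinant `ru - st = ±1`. This kills one of the three relator values for `η₁` and
`η₂`, and makes the third one `±` the first one for `η₃`.

Conversely, relator values that become Fox derivatives over `ℚ` are realised by the Bockstein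
construction `exists_cocycle₂_of_dvd_foxHom`: a crossed homomorphism to `ℤ/n` is given by its values
on the generators, and the coboundary of an integral lift, divided by `n`, is the cocycle. This
gives all of `H²` for `η₁` and `η₂`, and the torsion for `η₃`. For `η₃` a class of infinite order is
needed as well. Up to a factor of 2 the inclusion of the fibre group extends to a crossed
homomorphism from the group to `ℤ²` with the conjugation action, whose determinant is `η₃`. The cup
square of this crossed homomorphism, paired by the determinant, has first relator value `-4`
(`exists_relatorTriple_fst_ne_zero`). The values of the first relator therefore form an infinite
cyclic group, which is all that is needed for the isomorphism type.

In degree 1, cocycles are determined by their values on the generators, and the possible values are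
the kernel of the Fox matrix.
-/

open groupCohomology

/-! ### The extension of a group by a 2-cocycle -/

section Extension

variable {k Γ : Type} [CommRing k] [Group Γ] {A : Rep k Γ}

/-- The extension of `Γ` by `A` determined by a 2-cocycle `f`: the set `A × Γ` with the product
`(a, g) (b, h) = (a + g • b + f (g, h), g h)`. The cocycle need not be normalised, so the neutral
element is `(-f (1, 1), 1)`. -/
@[ext]
structure CocycleExtension (f : cocycles₂ A) where
  /-- The coordinate in the kernel. -/
  left : A
  /-- The coordinate in the quotient. -/
  right : Γ

namespace CocycleExtension

variable {f : cocycles₂ A}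

instance : Mul (CocycleExtension f) :=
  ⟨fun p q => ⟨p.left + A.ρ p.right q.left + f (p.right, q.right), p.right * q.right⟩⟩

instance : One (CocycleExtension f) := ⟨⟨-f (1, 1), 1⟩⟩

instance : Inv (CocycleExtension f) :=
  ⟨fun p => ⟨-A.ρ p.right⁻¹ p.left - f (p.right⁻¹, p.right) - f (1, 1), p.right⁻¹⟩⟩

@[simp] theorem mul_left (p q : CocycleExtension f) :
    (p * q).left = p.left + A.ρ p.right q.left + f (p.right, q.right) := rfl

@[simp] theorem mul_right (p q : CocycleExtension f) : (p * q).right = p.right * q.right := rfl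

@[simp] theorem one_left : (1 : CocycleExtension f).left = -f (1, 1) := rfl

@[simp] theorem one_right : (1 : CocycleExtension f).right = 1 := rfl

@[simp] theorem inv_left (p : CocycleExtension f) :
    p⁻¹.left = -A.ρ p.right⁻¹ p.left - f (p.right⁻¹, p.right) - f (1, 1) := rfl

@[simp] theorem inv_right (p : CocycleExtension f) : p⁻¹.right = p.right⁻¹ := rfl

instance : Group (CocycleExtension f) :=
  Group.ofLeftAxioms
    (fun p q w => by
      have h := (mem_cocycles₂_iff f).1 f.2 p.right q.right w.right
      ext
      · simp only [mul_left, mul_right, map_add, map_mul, Module.End.mul_apply]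
        calc
          _ = p.left + A.ρ p.right q.left + A.ρ p.right (A.ρ q.right w.left) +
              (f (p.right * q.right, w.right) + f (p.right, q.right)) := by abel
          _ = _ := by rw [h]; abel
      · simp [mul_assoc])
    (fun p => by
      ext
      · simp [cocycles₂_map_one_fst]
      · simp)
    (fun p => by
      ext
      · simp only [mul_left, inv_left, inv_right, one_left]
        abel
      · simp)

variable (f) in
/-- The projection of the extension onto `Γ`. -/
def proj : CocycleExtension f →* Γ where
  toFun := right
  map_one' := rfl
  map_mul' _ _ := rfl

variable (f) in
/-- The element of the kernel of the extension that corresponds to `x : A`. -/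
def incl (x : A) : CocycleExtension f := ⟨x - f (1, 1), 1⟩

theorem incl_injective : Function.Injective (incl f) := fun x y h => by
  simpa [incl] using congrArg left h

theorem incl_zero : incl f 0 = 1 := by
  ext <;> simp [incl]

theorem incl_add (x y : A) : incl f (x + y) = incl f x * incl f y := by
  ext
  · simp only [incl, mul_left, map_one, Module.End.one_apply]
    abel
  · simp [incl]

theorem incl_zsmul (n : ℤ) (x : A) : incl f (n • x) = incl f x ^ n :=
  map_zpow (⟨⟨fun y : Multiplicative A => incl f y.toAdd, incl_zero⟩, fun _ _ => incl_add _ _⟩ :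
    Multiplicative A →* CocycleExtension f) (Multiplicative.ofAdd x) n

theorem incl_neg (x : A) : incl f (-x) = (incl f x)⁻¹ := by
  simpa using incl_zsmul (f := f) (-1) x

theorem eq_incl_of_right_eq_one (p : CocycleExtension f) (hp : p.right = 1) :
    p = incl f (p.left + f (1, 1)) := by
  ext
  · simp [incl]
  · simp [incl, hp]

/-- The extension induces the given action of `Γ` on the kernel. -/
theorem mul_incl (p : CocycleExtension f) (x : A) : p * incl f x = incl f (A.ρ p.right x) * p := by
  ext
  · simp only [incl, mul_left, map_sub, cocycles₂_map_one_fst _ p.right,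
      cocycles₂_map_one_snd _ p.right, map_one, Module.End.one_apply]
    abel
  · simp [incl]

end CocycleExtension

end Extension

/-! ### Values of cocycles on the relators of a presentation -/

section Presentation

open CocycleExtension

variable {k X : Type} [CommRing k] {rels : Set (FreeGroup X)} {A : Rep k (PresentedGroup rels)}

/-- The homomorphism from the free group to the extension of a cocycle `f` that sends a generator
`x` to the lift of its image with kernel coordinate `v x`. -/
def freeLift (f : cocycles₂ A) (v : X → A) : FreeGroup X →* CocycleExtension f :=
  FreeGroup.lift fun x => ⟨v x, PresentedGroup.of x⟩

/-- The element of `A` to which a relator evaluates in the extension of `f`, when the generators are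
lifted with kernel coordinates `v`. For `f = 0` it is the value on the word `w` of the crossed
homomorphism with values `v` on the generators, that is, the Fox derivatives of `w` applied
to `v`. -/
def relatorValue (f : cocycles₂ A) (v : X → A) (w : FreeGroup X) : A :=
  (freeLift f v w).left + f (1, 1)

variable (f : cocycles₂ A) (v : X → A)

@[simp] theorem freeLift_of (x : X) :
    freeLift f v (FreeGroup.of x) = ⟨v x, PresentedGroup.of x⟩ := by
  simp [freeLift]

@[simp] theorem freeLift_right (w : FreeGroup X) :
    (freeLift f v w).right = PresentedGroup.mk rels w := by
  have : (proj f).comp (freeLift f v) = PresentedGroup.mk rels := by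
    ext x
    simp [proj, PresentedGroup.of]
  exact DFunLike.congr_fun this w

theorem freeLift_eq_incl {w : FreeGroup X} (hw : PresentedGroup.mk rels w = 1) :
    freeLift f v w = incl f (relatorValue f v w) :=
  eq_incl_of_right_eq_one _ (by simpa using hw)

variable {f v} in
/-- The kernel coordinate of `freeLift f v` is the only function on the free group whose coboundary
is the pull-back of `-f` and whose values on the generators are `v`. -/
theorem freeLift_left_eq {c : FreeGroup X → A} (hof : ∀ x, c (FreeGroup.of x) = v x)
    (hmul : ∀ w w', c (w * w') = c w + A.ρ (PresentedGroup.mk rels w) (c w') +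
      f (PresentedGroup.mk rels w, PresentedGroup.mk rels w')) (w : FreeGroup X) :
    (freeLift f v w).left = c w := by
  have : freeLift f v = MonoidHom.mk' (fun w => ⟨c w, PresentedGroup.mk rels w⟩) (fun w w' => by
      ext
      · simp [hmul]
      · simp) := by
    refine FreeGroup.ext_hom _ _ fun x => ?_
    simp [hof, PresentedGroup.of]
  rw [this]
  rfl

theorem relatorValue_add (f f' : cocycles₂ A) (v v' : X → A) (w : FreeGroup X) :
    relatorValue (f + f') (v + v') w = relatorValue f v w + relatorValue f' v' w := by
  have := freeLift_left_eq (f := f + f') (v := v + v')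
    (c := fun w => (freeLift f v w).left + (freeLift f' v' w).left) (fun x => by simp)
    (fun w w' => by
      change _ = _ + (f _ + f' _)
      simp only [map_mul, mul_left, freeLift_right, map_add]
      abel) w
  rw [relatorValue, this]
  change _ + (f _ + f' _) = _
  rw [relatorValue, relatorValue]
  abel

/-- The values of the relators in the extension of `f`, when every generator is lifted with kernel
coordinate `0`, as an additive function of the cocycle. -/
def relatorHom (w : FreeGroup X) : cocycles₂ A →+ A :=
  AddMonoidHom.mk' (fun f => relatorValue f 0 w) fun f f' => by
    rw [← relatorValue_add, add_zero]

/-- Fox calculus: the value on the word `w` of the crossed homomorphism with given values on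
the generators, as an additive function of these values. -/
def foxHom (w : FreeGroup X) : (X → A) →+ A :=
  AddMonoidHom.mk' (fun v => relatorValue 0 v w) fun v v' => by
    rw [← relatorValue_add, add_zero]

theorem relatorValue_eq (w : FreeGroup X) :
    relatorValue f v w = relatorHom w f + foxHom w v := by
  have := relatorValue_add f 0 0 v w
  rwa [add_zero, zero_add] at this

@[simp] theorem foxHom_of (x : X) : foxHom (FreeGroup.of x) v = v x := by
  change (freeLift 0 v _).left + (0 : A) = _
  simp

@[simp] theorem foxHom_mul (w w' : FreeGroup X) :
    foxHom (w * w') v = foxHom w v + A.ρ (PresentedGroup.mk rels w) (foxHom w' v) := by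
  change (freeLift 0 v _).left + (0 : A) = (freeLift 0 v _).left + (0 : A) +
    A.ρ _ ((freeLift 0 v _).left + (0 : A))
  simp only [map_mul, mul_left, freeLift_right, add_zero]
  exact add_zero _

@[simp] theorem foxHom_one : foxHom (1 : FreeGroup X) v = 0 := by
  simpa using foxHom_mul v 1 1

@[simp] theorem foxHom_inv (w : FreeGroup X) :
    foxHom w⁻¹ v = -A.ρ (PresentedGroup.mk rels w)⁻¹ (foxHom w v) := by
  have := foxHom_mul v w⁻¹ w
  rw [inv_mul_cancel, foxHom_one, map_inv] at this
  exact eq_neg_of_add_eq_zero_left this.symm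

theorem foxHom_zpow {w : FreeGroup X} (hw : A.ρ (PresentedGroup.mk rels w) = 1) (n : ℤ) :
    foxHom (w ^ n) v = n • foxHom w v := by
  have hinv : A.ρ (PresentedGroup.mk rels w)⁻¹ = 1 := by
    simpa [hw] using (map_mul A.ρ (PresentedGroup.mk rels w)⁻¹ (PresentedGroup.mk rels w)).symm
  induction n with
  | zero => simp
  | succ n ih => rw [add_comm, zpow_add, zpow_one, foxHom_mul, hw, ih, add_smul, one_smul]; rfl
  | pred n ih =>
    rw [sub_eq_add_neg, add_comm, zpow_add, zpow_neg_one, foxHom_mul, foxHom_inv,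
      map_inv (PresentedGroup.mk rels), hinv, ih,
      add_smul, neg_one_smul]
    rfl

variable {f v} in
/-- If the relators evaluate to `0` in the extension, then the extension has a section with
the prescribed values on the generators. -/
theorem exists_section (h : ∀ w ∈ rels, relatorValue f v w = 0) :
    ∃ c : PresentedGroup rels → A, (∀ x, c (PresentedGroup.of x) = v x) ∧
      ∀ g g', c (g * g') = c g + A.ρ g (c g') + f (g, g') := by
  have hrel : ∀ w ∈ rels, freeLift f v w = 1 := fun w hw => by
    rw [freeLift_eq_incl f v (PresentedGroup.one_of_mem hw), h w hw, incl_zero]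
  let F : PresentedGroup rels →* CocycleExtension f := PresentedGroup.toGroup hrel
  have hof : ∀ x, F (PresentedGroup.of x) = ⟨v x, PresentedGroup.of x⟩ := fun x =>
    PresentedGroup.toGroup.of hrel
  have hF : (proj f).comp F = MonoidHom.id _ := by
    ext x
    simp [hof, proj]
  have hright : ∀ g, (F g).right = g := fun g => DFunLike.congr_fun hF g
  refine ⟨fun g => (F g).left, fun x => by simp [hof], fun g g' => ?_⟩
  simp [hright]

variable {f} in
theorem relatorValue_eq_zero_of_section {c : PresentedGroup rels → A}
    (hc : ∀ g g', c (g * g') = c g + A.ρ g (c g') + f (g, g')) {w : FreeGroup X}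
    (hw : PresentedGroup.mk rels w = 1) :
    relatorValue f (fun x => c (PresentedGroup.of x)) w = 0 := by
  have := freeLift_left_eq (f := f) (v := fun x => c (PresentedGroup.of x))
    (c := fun w => c (PresentedGroup.mk rels w)) (fun x => rfl) (fun w w' => by simp [hc]) w
  rw [relatorValue, this, hw]
  have h1 := hc 1 1
  simp only [mul_one, map_one, Module.End.one_apply, add_assoc] at h1
  exact left_eq_add.1 h1

/-- A 2-cocycle is a coboundary exactly when its values on the relators are Fox derivatives. -/
theorem mem_coboundaries₂_iff_relatorHom :
    (f : PresentedGroup rels × PresentedGroup rels → A) ∈ coboundaries₂ A ↔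
      ∃ v : X → A, ∀ w ∈ rels, relatorHom w f = foxHom w v := by
  constructor
  · rintro ⟨h, hh⟩
    refine ⟨fun x => h (PresentedGroup.of x), fun w hw => ?_⟩
    have hh' : ∀ g g', f (g, g') = A.ρ g (h g') - h (g * g') + h g := fun g g' =>
      (congrFun hh (g, g')).symm
    have := relatorValue_eq_zero_of_section (f := f) (c := fun g => -h g)
      (fun g g' => by rw [hh', map_neg]; abel) (PresentedGroup.one_of_mem hw)
    rw [relatorValue_eq] at this
    rw [eq_neg_of_add_eq_zero_left this, ← map_neg]
    congr 1
    ext x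
    simp
  · rintro ⟨v, hv⟩
    obtain ⟨c, -, hc⟩ := exists_section (f := f) (v := -v) fun w hw => by
      rw [relatorValue_eq, hv w hw, map_neg, add_neg_cancel]
    refine ⟨fun g => -c g, ?_⟩
    funext ⟨g, g'⟩
    change A.ρ g (-c g') - -c (g * g') + -c g = f (g, g')
    rw [hc, map_neg]
    abel

/-- A function on the generators extends to a 1-cocycle if it kills the relators. -/
theorem exists_cocycle₁ (h : ∀ w ∈ rels, foxHom w v = 0) :
    ∃ c : cocycles₁ A, ∀ x, c (PresentedGroup.of x) = v x := by
  obtain ⟨c, hc, hmul⟩ := exists_section (f := 0) (v := v) h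
  refine ⟨⟨c, (mem_cocycles₁_iff _).2 fun g g' => ?_⟩, hc⟩
  rw [hmul, add_comm (A.ρ g _)]
  exact add_zero _

theorem foxHom_cocycle₁ (c : cocycles₁ A) {w : FreeGroup X} (hw : PresentedGroup.mk rels w = 1) :
    foxHom w (fun x => c (PresentedGroup.of x)) = 0 :=
  relatorValue_eq_zero_of_section (f := 0) (c := c) (fun g g' => by
    rw [(mem_cocycles₁_iff c).1 c.2 g g', add_comm]
    exact (add_zero _).symm) hw

theorem cocycles₁_ext_of {c c' : cocycles₁ A}
    (h : ∀ x : X, c (PresentedGroup.of x) = c' (PresentedGroup.of x)) : c = c' := by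
  ext g
  induction g with | _ w
  have key : ∀ d : cocycles₁ A, (freeLift 0 (fun x => d (PresentedGroup.of x)) w).left =
      d (PresentedGroup.mk rels w) := fun d =>
    freeLift_left_eq (c := fun w => d (PresentedGroup.mk rels w)) (fun x => rfl) (fun w w' => by
      rw [map_mul, (mem_cocycles₁_iff d).1 d.2, add_comm (A.ρ _ _)]
      exact (add_zero _).symm) w
  rw [← key c, ← key c', funext h]

end Presentation

/-! ### Cohomology as a quotient of cocycles -/

section Quotients

variable {k Γ : Type} [CommRing k] [Group Γ] {A : Rep k Γ} {Q : Type*} [AddCommGroup Q]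

/-- A surjective homomorphism from the 1-cocycles whose kernel is the coboundaries computes `H¹`. -/
theorem nonempty_H1_addEquiv (φ : cocycles₁ A →+ Q) (hφ : Function.Surjective φ)
    (hker : ∀ f : cocycles₁ A, φ f = 0 ↔ (f : Γ → A) ∈ coboundaries₁ A) :
    Nonempty (groupCohomology A 1 ≃+ Q) := by
  let π : cocycles₁ A →+ groupCohomology A 1 := (H1π A).hom.toAddMonoidHom
  have hπ : Function.Surjective π := (ModuleCat.epi_iff_surjective _).1 inferInstance
  have hk : π.ker = φ.ker := by
    ext f
    rw [AddMonoidHom.mem_ker, AddMonoidHom.mem_ker, hker]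
    exact H1π_eq_zero_iff f
  exact ⟨(QuotientAddGroup.quotientKerEquivOfSurjective π hπ).symm.trans
    ((QuotientAddGroup.quotientAddEquivOfEq hk).trans
      (QuotientAddGroup.quotientKerEquivOfSurjective φ hφ))⟩

/-- A surjective homomorphism from the 2-cocycles whose kernel is the coboundaries computes `H²`. -/
theorem nonempty_H2_addEquiv (φ : cocycles₂ A →+ Q) (hφ : Function.Surjective φ)
    (hker : ∀ f : cocycles₂ A, φ f = 0 ↔ (f : Γ × Γ → A) ∈ coboundaries₂ A) :
    Nonempty (groupCohomology A 2 ≃+ Q) := by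
  let π : cocycles₂ A →+ groupCohomology A 2 := (H2π A).hom.toAddMonoidHom
  have hπ : Function.Surjective π := (ModuleCat.epi_iff_surjective _).1 inferInstance
  have hk : π.ker = φ.ker := by
    ext f
    rw [AddMonoidHom.mem_ker, AddMonoidHom.mem_ker, hker]
    exact H2π_eq_zero_iff f
  exact ⟨(QuotientAddGroup.quotientKerEquivOfSurjective π hπ).symm.trans
    ((QuotientAddGroup.quotientAddEquivOfEq hk).trans
      (QuotientAddGroup.quotientKerEquivOfSurjective φ hφ))⟩

end Quotients

/-! ### Change of coefficients and the Bockstein construction -/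

section Coefficients

variable {k X : Type} [CommRing k] {rels : Set (FreeGroup X)} {A B : Rep k (PresentedGroup rels)}

/-- Fox derivatives are natural in the coefficients. -/
theorem map_foxHom (φ : A →+ B) (hφ : ∀ g x, φ (A.ρ g x) = B.ρ g (φ x)) (v : X → A)
    (w : FreeGroup X) : φ (foxHom w v) = foxHom w fun x => φ (v x) := by
  induction w using FreeGroup.induction_on with
  | C1 => simp
  | of x => simp
  | inv_of x h => simp [hφ]
  | mul w w' h h' => rw [foxHom_mul, foxHom_mul, map_add, hφ, h, h']

/-- The representation on an abelian group in which `g` acts as multiplication by the sign `η g`. -/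
def signRepresentation {Γ : Type} [Group Γ] (η : Γ →* ℤˣ) (M : Type) [AddCommGroup M] :
    Representation ℤ Γ M where
  toFun g := ((η g : ℤˣ) : ℤ) • LinearMap.id
  map_one' := by
    ext
    simp
  map_mul' g h := by
    ext
    simp [mul_smul]

theorem intCast_zmod_natAbs_eq_zero_iff (n x : ℤ) : (x : ZMod n.natAbs) = 0 ↔ n ∣ x := by
  rw [ZMod.intCast_zmod_eq_zero_iff_dvd]
  exact Int.natAbs_dvd

/-- The Bockstein construction: if the Fox derivatives `foxHom w v` of the relators are divisible
by `n`, then `v` is a crossed homomorphism to `ℤ/n`, and the relator values of its Bockstein image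
are the quotients by `n`, up to integral Fox derivatives. Hence all relator values that become Fox
derivatives over `ℚ` come from cocycles. -/
theorem exists_cocycle₂_of_dvd_foxHom (η : PresentedGroup rels →* ℤˣ) {n : ℤ} (hn : n ≠ 0)
    (v : X → ℤ) (h : ∀ w ∈ rels, n ∣ foxHom (A := twistedInt η) w v) :
    ∃ (f : cocycles₂ (twistedInt η)) (z : X → ℤ), ∀ w ∈ rels, n * relatorHom w f =
      foxHom (A := twistedInt η) w v + n * foxHom (A := twistedInt η) w z := by
  let N := n.natAbs
  let B : Rep ℤ (PresentedGroup rels) := Rep.of (signRepresentation η (ZMod N))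
  have hact : ∀ g (x : ℤ), (twistedInt η).ρ g x = ((η g : ℤˣ) : ℤ) * x := fun _ _ => rfl
  have hactB : ∀ g (x : ZMod N), B.ρ g x = ((η g : ℤˣ) : ℤ) • x := fun _ _ => rfl
  have hcast : ∀ x : ℤ, (x : ZMod N) = 0 ↔ n ∣ x := intCast_zmod_natAbs_eq_zero_iff n
  obtain ⟨c, hc⟩ := exists_cocycle₁ (A := B) (fun x => (v x : ZMod N)) fun w hw => by
    have := map_foxHom (A := twistedInt η) (B := B) (Int.castAddHom (ZMod N))
      (fun g x => by
        rw [hact, hactB]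
        simp) v w
    refine this.symm.trans ?_
    exact (hcast _).2 (h w hw)
  -- An integral lift of the crossed homomorphism; its coboundary is `n` times the cocycle sought.
  choose H hH using fun g => ZMod.intCast_surjective (c g : ZMod N)
  have hdvd : ∀ g g', n ∣ H (g * g') - H g - ((η g : ℤˣ) : ℤ) * H g' := fun g g' => by
    have := (mem_cocycles₁_iff c).1 c.2 g g'
    rw [← hcast]
    push_cast
    rw [hH, hH, hH]
    rw [show c (g * g') = ((η g : ℤˣ) : ℤ) • (c g' : ZMod N) + c g from this, zsmul_eq_mul]
    ring
  choose F hF using hdvd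
  have hmem : (fun p : PresentedGroup rels × PresentedGroup rels => F p.1 p.2) ∈
      cocycles₂ (twistedInt η) := (mem_cocycles₂_iff _).2 fun g g' g'' => by
    change F (g * g') g'' + F g g' = ((η g : ℤˣ) : ℤ) * F g' g'' + F g (g' * g'')
    refine mul_left_cancel₀ hn ?_
    have h1 := hF (g * g') g''
    have h2 := hF g (g' * g'')
    rw [map_mul, Units.val_mul] at h1
    rw [← mul_assoc g] at h2
    linear_combination -h1 - hF g g' + ((η g : ℤˣ) : ℤ) * hF g' g'' + h2
  let f : cocycles₂ (twistedInt η) := ⟨_, hmem⟩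
  have hz : ∀ x, n ∣ H (PresentedGroup.of x) - v x := fun x => by
    rw [← hcast]
    push_cast
    rw [hH, hc, sub_self]
  choose z hz using hz
  refine ⟨-f, z, fun w hw => ?_⟩
  have hsec := relatorValue_eq_zero_of_section (f := n • f) (c := H) (fun g g' => by
    change H (g * g') = H g + ((η g : ℤˣ) : ℤ) * H g' + n * F g g'
    rw [← hF]
    ring) (PresentedGroup.one_of_mem hw)
  have hv : (fun x => H (PresentedGroup.of x)) = v + n • z := by
    funext x
    change H _ = v x + n * z x
    rw [← hz]
    ring
  rw [relatorValue_eq, hv, map_add (foxHom w), map_zsmul, map_zsmul] at hsec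
  rw [map_neg]
  change n * relatorHom w f + (foxHom (A := twistedInt η) w v +
    n * foxHom (A := twistedInt η) w z) = 0 at hsec
  change n * -(relatorHom w f : ℤ) = _
  linear_combination -hsec

end Coefficients

namespace Sapphire

open CocycleExtension

/-! ### Commutators in central extensions of `ℤ²` and of the Klein bottle group -/

section Commutation

variable {E : Type*} [Group E]

/-- In an extension of the Klein bottle group, the relator value `z` of `a y a⁻¹ = y⁻¹` determines
the commutator of `a²` and `y`. -/
theorem sq_mul_of_conj_eq {a y z z' : E} (h : a * y * a⁻¹ * (y⁻¹)⁻¹ = z) (hz : a * z = z' * a)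
    (hzy : Commute z y) : a ^ 2 * y = z' * z⁻¹ * (y * a ^ 2) := by
  have h1 : a * y = z * y⁻¹ * a := by rw [← h]; group
  have h2 : a * y⁻¹ = y * z⁻¹ * a := by
    have : a * y⁻¹ = (a * y * a⁻¹)⁻¹ * a := by group
    rw [this, h1]; group
  calc a ^ 2 * y = a * (a * y) := by rw [pow_two, mul_assoc]
    _ = a * z * y⁻¹ * a := by rw [h1]; group
    _ = z' * (a * y⁻¹) * a := by rw [hz]; group
    _ = z' * (y * z⁻¹) * a ^ 2 := by rw [h2, pow_two]; group
    _ = z' * (z⁻¹ * y) * a ^ 2 := by rw [hzy.inv_left.eq]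
    _ = _ := by simp only [mul_assoc]

theorem mul_zpow_of_mul_eq {x y q : E} (h : x * y = q * (y * x)) (hq : Commute q y) (n : ℤ) :
    x * y ^ n = q ^ n * (y ^ n * x) := by
  have : x * y * x⁻¹ = q * y := by rw [h]; group
  rw [← mul_assoc, ← hq.mul_zpow, ← this, conj_zpow, inv_mul_cancel_right]

theorem zpow_mul_zpow_of_mul_eq {x y q : E} (h : x * y = q * (y * x)) (hx : Commute q x)
    (hy : Commute q y) (m n : ℤ) : x ^ m * y ^ n = q ^ (m * n) * (y ^ n * x ^ m) := by
  have h1 := mul_zpow_of_mul_eq h hy n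
  have h2 : y ^ n * x = (q ^ n)⁻¹ * (x * y ^ n) := by rw [h1]; group
  have h3 := mul_zpow_of_mul_eq h2 (hx.zpow_left n).inv_left m
  rw [h3, ← mul_assoc, inv_zpow, ← zpow_mul, mul_comm m, mul_inv_cancel, one_mul]

/-- In a Heisenberg group, the commutator is multiplied by the determinant under a change of
basis. -/
theorem commutator_of_det {x y q : E} (h : x * y = q * (y * x)) (hx : Commute q x)
    (hy : Commute q y) (r s t u : ℤ) :
    x ^ r * y ^ s * (x ^ t * y ^ u) =
      q ^ (r * u - s * t) * (x ^ t * y ^ u * (x ^ r * y ^ s)) := by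
  have e1 : y ^ s * x ^ t = q ^ (-(t * s)) * (x ^ t * y ^ s) := by
    rw [zpow_mul_zpow_of_mul_eq h hx hy]; group
  have e2 : y ^ u * x ^ r = q ^ (-(r * u)) * (x ^ r * y ^ u) := by
    rw [zpow_mul_zpow_of_mul_eq h hx hy]; group
  have c1 : ∀ i j : ℤ, x ^ i * q ^ j = q ^ j * x ^ i := fun i j =>
    ((hx.zpow_left j).zpow_right i).eq.symm
  calc x ^ r * y ^ s * (x ^ t * y ^ u) = x ^ r * (y ^ s * x ^ t) * y ^ u := by group
    _ = x ^ r * q ^ (-(t * s)) * (x ^ t * y ^ (s + u)) := by rw [e1]; group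
    _ = q ^ (-(t * s)) * (x ^ (r + t) * y ^ (s + u)) := by rw [c1]; group
    _ = q ^ (r * u - s * t) * (q ^ (-(r * u)) * (x ^ (r + t) * y ^ (s + u))) := by
      rw [← mul_assoc (q ^ _) (q ^ _), ← zpow_add]
      congr 2
      ring
    _ = q ^ (r * u - s * t) * (x ^ t * q ^ (-(r * u)) * x ^ r * y ^ (s + u)) := by
      rw [c1]; group
    _ = q ^ (r * u - s * t) * (x ^ t * (y ^ u * x ^ r) * y ^ s) := by rw [e2]; group
    _ = _ := by group

end Commutation

/-! ### Fox derivatives of the relators and the identity among the relations -/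

section Relators

variable (r s t u : ℤ)

/-- The relator of `a₁ b₁ a₁⁻¹ = b₁⁻¹`. -/
def rel₁ : FreeGroup SapphireGen :=
  .of .a1 * .of .b1 * (.of .a1)⁻¹ * ((.of .b1)⁻¹)⁻¹

/-- The relator of `a₂² = a₁^(2r) b₁^s`. -/
def rel₂ : FreeGroup SapphireGen :=
  .of .a2 ^ 2 * (.of .a1 ^ (2 * r) * .of .b1 ^ s)⁻¹

/-- The relator of `a₂ a₁^(2t) b₁^u a₂⁻¹ = b₁^(-u) a₁^(-2t)`. -/
def rel₃ : FreeGroup SapphireGen :=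
  .of .a2 * .of .a1 ^ (2 * t) * .of .b1 ^ u * (.of .a2)⁻¹ *
    (.of .b1 ^ (-u) * .of .a1 ^ (-2 * t))⁻¹

theorem forall_mem_rels {P : FreeGroup SapphireGen → Prop} :
    (∀ w ∈ rels r s t u, P w) ↔ P rel₁ ∧ P (rel₂ r s) ∧ P (rel₃ t u) := by
  refine ⟨fun h => ⟨h _ (.inl rfl), h _ (.inr (.inl rfl)), h _ (.inr (.inr rfl))⟩, ?_⟩
  rintro ⟨h1, h2, h3⟩ w (rfl | rfl | rfl)
  exacts [h1, h2, h3]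

theorem mk_of_a1 : PresentedGroup.mk (rels r s t u) (.of .a1) = a₁ r s t u := rfl

theorem mk_of_b1 : PresentedGroup.mk (rels r s t u) (.of .b1) = b₁ r s t u := rfl

theorem mk_of_a2 : PresentedGroup.mk (rels r s t u) (.of .a2) = a₂ r s t u := rfl

variable {r s t u} {k : Type} [CommRing k] (A : Rep k (G r s t u))

/-- The action factors through the maximal quotient `ℤ/2 * ℤ/2` in which `b₁`, `a₁²` and `a₂²`
become trivial. -/
structure FactorsThroughDihedral : Prop where
  b₁ : A.ρ (b₁ r s t u) = 1
  a₁ : A.ρ (a₁ r s t u) * A.ρ (a₁ r s t u) = 1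
  a₂ : A.ρ (a₂ r s t u) * A.ρ (a₂ r s t u) = 1

variable {A} (hA : FactorsThroughDihedral A) (v : SapphireGen → A)
include hA

theorem FactorsThroughDihedral.sq_apply_a₁ (x : A) :
    A.ρ (Sapphire.a₁ r s t u) (A.ρ (Sapphire.a₁ r s t u) x) = x :=
  LinearMap.congr_fun hA.a₁ x

theorem FactorsThroughDihedral.sq_apply_a₂ (x : A) :
    A.ρ (Sapphire.a₂ r s t u) (A.ρ (Sapphire.a₂ r s t u) x) = x :=
  LinearMap.congr_fun hA.a₂ x

theorem FactorsThroughDihedral.inv_a₁ :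
    A.ρ (Sapphire.a₁ r s t u)⁻¹ = A.ρ (Sapphire.a₁ r s t u) :=
  left_inv_eq_right_inv (by rw [← map_mul, inv_mul_cancel, map_one]) hA.a₁

theorem FactorsThroughDihedral.inv_a₂ :
    A.ρ (Sapphire.a₂ r s t u)⁻¹ = A.ρ (Sapphire.a₂ r s t u) :=
  left_inv_eq_right_inv (by rw [← map_mul, inv_mul_cancel, map_one]) hA.a₂

theorem FactorsThroughDihedral.b₁_zpow (n : ℤ) : A.ρ (Sapphire.b₁ r s t u ^ n) = 1 :=
  zpow_mem (K := MonoidHom.ker A.ρ) hA.b₁ n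

theorem FactorsThroughDihedral.a₁_zpow (n : ℤ) : A.ρ (Sapphire.a₁ r s t u ^ (2 * n)) = 1 := by
  rw [zpow_mul]
  refine zpow_mem (K := MonoidHom.ker A.ρ) ?_ n
  rw [MonoidHom.mem_ker, zpow_ofNat, pow_two, map_mul]
  exact hA.a₁

theorem foxHom_a₁_zpow (n : ℤ) : foxHom (.of .a1 ^ (2 * n) : FreeGroup SapphireGen) v =
    n • (v .a1 + A.ρ (Sapphire.a₁ r s t u) (v .a1)) := by
  rw [zpow_mul, foxHom_zpow]
  · rw [zpow_ofNat, pow_two, foxHom_mul, foxHom_of]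
    rfl
  · have := hA.a₁_zpow 1
    rwa [mul_one] at this

theorem foxHom_b₁_zpow (n : ℤ) : foxHom (.of .b1 ^ n : FreeGroup SapphireGen) v = n • v .b1 := by
  rw [foxHom_zpow _ hA.b₁, foxHom_of]

theorem foxHom_rel₁ : foxHom rel₁ v = v .b1 + A.ρ (Sapphire.a₁ r s t u) (v .b1) := by
  simp only [rel₁, inv_inv, foxHom_mul, foxHom_inv, foxHom_of, map_mul, map_inv, mk_of_a1, mk_of_b1,
    hA.b₁, hA.inv_a₁, mul_one, hA.a₁, map_neg, hA.sq_apply_a₁, Module.End.one_apply]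
  abel

theorem foxHom_rel₂ : foxHom (rel₂ r s) v = v .a2 + A.ρ (Sapphire.a₂ r s t u) (v .a2) -
    (r • (v .a1 + A.ρ (Sapphire.a₁ r s t u) (v .a1)) + s • v .b1) := by
  have h2 : A.ρ (a₁ r s t u ^ (2 * r) * b₁ r s t u ^ s)⁻¹ = 1 := by
    refine (MonoidHom.ker A.ρ).inv_mem (mul_mem ?_ ?_)
    exacts [hA.a₁_zpow r, hA.b₁_zpow s]
  simp only [rel₂, foxHom_mul, foxHom_inv, foxHom_a₁_zpow hA, foxHom_b₁_zpow hA, pow_two, foxHom_of,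
    map_mul (PresentedGroup.mk _), map_zpow (PresentedGroup.mk _), mk_of_a1, mk_of_b1, mk_of_a2, h2,
    hA.a₁_zpow, Module.End.one_apply]
  rw [map_mul A.ρ, hA.a₂]
  exact (sub_eq_add_neg _ _).symm

theorem foxHom_rel₃ : foxHom (rel₃ t u) v =
    t • (v .a1 + A.ρ (Sapphire.a₁ r s t u) (v .a1)) + u • v .b1 + A.ρ (Sapphire.a₂ r s t u)
      (t • (v .a1 + A.ρ (Sapphire.a₁ r s t u) (v .a1)) + u • v .b1) := by
  have h1 : rel₃ t u = .of .a2 * (.of .a1 ^ (2 * t) * .of .b1 ^ u) * (.of .a2)⁻¹ *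
      (.of .a1 ^ (2 * t) * .of .b1 ^ u) := by
    simp only [rel₃]
    group
  rw [h1]
  simp only [foxHom_mul, foxHom_inv, foxHom_a₁_zpow hA, foxHom_b₁_zpow hA, foxHom_of, map_mul,
    map_zpow (PresentedGroup.mk _), map_inv, mk_of_a1, mk_of_b1, mk_of_a2, hA.a₁_zpow, hA.b₁_zpow,
    hA.inv_a₂, mul_one, hA.a₂, map_neg, hA.sq_apply_a₂, Module.End.one_apply]
  abel

/-- The identity among the relations: the attaching map of the 3-cell of the manifold.
Both sides measure the commutator, in the extension of `f`, of lifts of the two basis pairs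
`a₁², b₁` and `a₂², a₁^(2t) b₁^u` of the fibre group `ℤ²`; the base change has determinant
`ru - st`. -/
theorem relatorHom_rel₃ (f : cocycles₂ A) :
    A.ρ (Sapphire.a₂ r s t u) (relatorHom (rel₃ t u) f) - relatorHom (rel₃ t u) f =
      (r * u - s * t) •
        (A.ρ (Sapphire.a₁ r s t u) (relatorHom rel₁ f) - relatorHom rel₁ f) := by
  set a : CocycleExtension f := ⟨0, a₁ r s t u⟩
  set b : CocycleExtension f := ⟨0, b₁ r s t u⟩
  set c : CocycleExtension f := ⟨0, a₂ r s t u⟩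
  obtain ⟨h1, h2, h3⟩ := (forall_mem_rels r s t u).1 fun w hw =>
    freeLift_eq_incl f 0 (PresentedGroup.one_of_mem hw)
  change freeLift f 0 rel₁ = incl f (relatorHom rel₁ f) at h1
  change freeLift f 0 (rel₂ r s) = incl f (relatorHom (rel₂ r s) f) at h2
  change freeLift f 0 (rel₃ t u) = incl f (relatorHom (rel₃ t u) f) at h3
  generalize relatorHom rel₁ f = p at h1 ⊢
  generalize relatorHom (rel₂ r s) f = q at h2
  generalize relatorHom (rel₃ t u) f = w at h3 ⊢
  simp only [rel₁, rel₂, rel₃, map_mul, map_inv, map_zpow, map_pow, freeLift_of, Pi.zero_apply]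
    at h1 h2 h3
  change a * b * a⁻¹ * (b⁻¹)⁻¹ = _ at h1
  change c ^ 2 * (a ^ (2 * r) * b ^ s)⁻¹ = _ at h2
  change c * a ^ (2 * t) * b ^ u * c⁻¹ * (b ^ (-u) * a ^ (-2 * t))⁻¹ = _ at h3
  have hcomm : ∀ (e : CocycleExtension f) (x : A), A.ρ e.right = 1 → Commute (incl f x) e :=
    fun e x he => by
      have := mul_incl e x
      rw [he] at this
      exact this.symm
  have hright : ∀ (e : CocycleExtension f) (n : ℤ), (e ^ n).right = e.right ^ n := fun e n =>
    map_zpow (proj f) e n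
  have hb' : A.ρ b.right = 1 := hA.b₁
  have hx' : A.ρ (a ^ 2).right = 1 := by
    rw [pow_two, mul_right, map_mul]
    exact hA.a₁
  have hW' : A.ρ ((a ^ 2) ^ t * b ^ u).right = 1 := by
    rw [mul_right, map_mul, hright, hright]
    exact (congrArg₂ _ (zpow_mem (K := MonoidHom.ker A.ρ) hx' t)
      (zpow_mem (K := MonoidHom.ker A.ρ) hb' u)).trans (mul_one _)
  have e1 := sq_mul_of_conj_eq h1 (mul_incl a p) (hcomm b p hb')
  rw [← incl_neg, ← incl_add, ← sub_eq_add_neg] at e1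
  have e3 : c * ((a ^ 2) ^ t * b ^ u) * c⁻¹ * (((a ^ 2) ^ t * b ^ u)⁻¹)⁻¹ = incl f w := by
    rw [← h3, ← zpow_natCast, ← zpow_mul]
    group
  have e3' := sq_mul_of_conj_eq e3 (mul_incl c w) (hcomm _ w hW')
  rw [← incl_neg, ← incl_add, ← sub_eq_add_neg] at e3'
  have e2 : c ^ 2 = incl f q * ((a ^ 2) ^ r * b ^ s) := by
    rw [← h2, ← zpow_natCast a, ← zpow_mul]
    group
  have e4 := commutator_of_det e1 (hcomm _ _ hx') (hcomm _ _ hb') r s t u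
  rw [← incl_zsmul] at e4
  have e5 : c ^ 2 * ((a ^ 2) ^ t * b ^ u) =
      incl f ((r * u - s * t) • (A.ρ (a₁ r s t u) p - p)) * ((a ^ 2) ^ t * b ^ u * c ^ 2) := by
    rw [e2, mul_assoc, e4]
    generalize (r * u - s * t) • (A.ρ a.right p - p) = y
    have c1 := hcomm _ q hW'
    have c2 : incl f q * incl f y = incl f y * incl f q := by
      rw [← incl_add, ← incl_add, add_comm]
    rw [← mul_assoc, c2, mul_assoc, ← mul_assoc (incl f q), c1.eq, mul_assoc]
  exact incl_injective (mul_right_cancel (e3'.symm.trans e5))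

end Relators

/-! ### Coefficients in `ℤ` with a sign action -/

section SignCoefficients

variable {r s t u : ℤ} {ε₁ ε₂ : ℤˣ}

theorem factorsThroughDihedral_twistedInt :
    FactorsThroughDihedral (twistedInt (eta r s t u ε₁ ε₂)) := by
  have hact : ∀ g (x : ℤ), (twistedInt (eta r s t u ε₁ ε₂)).ρ g x =
    ((eta r s t u ε₁ ε₂ g : ℤˣ) : ℤ) * x := fun _ _ => rfl
  have hsq : ∀ (ε : ℤˣ) (x : ℤ), (ε : ℤ) * ((ε : ℤ) * x) = x := fun ε x => by
    rw [← mul_assoc, ← Units.val_mul, Int.units_mul_self, Units.val_one, one_mul]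
  refine ⟨LinearMap.ext fun x => ?_, LinearMap.ext fun x => ?_, LinearMap.ext fun x => ?_⟩
  · rw [hact, eta_b₁]
    exact one_mul x
  · rw [Module.End.mul_apply, hact, hact, eta_a₁]
    exact hsq ε₁ x
  · rw [Module.End.mul_apply, hact, hact, eta_a₂]
    exact hsq ε₂ x

/-- The function on the generators with values `α` on `a₁`, `β` on `b₁` and `γ` on `a₂`. -/
def genValues (α β γ : ℤ) : SapphireGen → ℤ
  | .a1 => α
  | .b1 => β
  | .a2 => γ

variable (r s t u ε₁ ε₂) in
/-- The differential `ℤ³ → ℤ³` from 1-cochains to 2-cochains of the presentation complex with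
coefficients `ℤ_η`: the Fox derivatives of the three relators. -/
def foxTriple (α β γ : ℤ) : ℤ × ℤ × ℤ :=
  (β + ε₁ * β, γ + ε₂ * γ - (r * (α + ε₁ * α) + s * β),
    (t * (α + ε₁ * α) + u * β) + ε₂ * (t * (α + ε₁ * α) + u * β))

/-- The values of a cocycle on the three relators. -/
def relatorTriple : cocycles₂ (twistedInt (eta r s t u ε₁ ε₂)) →+ ℤ × ℤ × ℤ :=
  AddMonoidHom.prod (relatorHom rel₁) (AddMonoidHom.prod (relatorHom (rel₂ r s))
    (relatorHom (rel₃ t u)))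

theorem foxHom_rels (v : SapphireGen → ℤ) :
    ((foxHom (A := twistedInt (eta r s t u ε₁ ε₂)) rel₁ v : ℤ),
      (foxHom (A := twistedInt (eta r s t u ε₁ ε₂)) (rel₂ r s) v : ℤ),
      (foxHom (A := twistedInt (eta r s t u ε₁ ε₂)) (rel₃ t u) v : ℤ)) =
      foxTriple r s t u ε₁ ε₂ (v .a1) (v .b1) (v .a2) := by
  have h := factorsThroughDihedral_twistedInt (r := r) (s := s) (t := t) (u := u)
    (ε₁ := ε₁) (ε₂ := ε₂)
  rw [foxHom_rel₁ h, foxHom_rel₂ h, foxHom_rel₃ h]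
  have h1 : ∀ x : ℤ, (twistedInt (eta r s t u ε₁ ε₂)).ρ (a₁ r s t u) x = (ε₁ : ℤ) * x := fun x =>
    congrArg (fun ε : ℤˣ => (ε : ℤ) * x) (eta_a₁ r s t u ε₁ ε₂)
  have h2 : ∀ x : ℤ, (twistedInt (eta r s t u ε₁ ε₂)).ρ (a₂ r s t u) x = (ε₂ : ℤ) * x := fun x =>
    congrArg (fun ε : ℤˣ => (ε : ℤ) * x) (eta_a₂ r s t u ε₁ ε₂)
  rw [h1, h1, h2, h2]
  rfl

/-- The identity among the relations, for coefficients `ℤ_η`. -/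
theorem relatorTriple_identity (f : cocycles₂ (twistedInt (eta r s t u ε₁ ε₂))) :
    ε₂ * (relatorTriple f).2.2 - (relatorTriple f).2.2 =
      (r * u - s * t) * (ε₁ * (relatorTriple f).1 - (relatorTriple f).1) := by
  have h := relatorHom_rel₃ factorsThroughDihedral_twistedInt f
  have h1 : ∀ x : ℤ, (twistedInt (eta r s t u ε₁ ε₂)).ρ (a₁ r s t u) x = (ε₁ : ℤ) * x := fun x =>
    congrArg (fun ε : ℤˣ => (ε : ℤ) * x) (eta_a₁ r s t u ε₁ ε₂)
  have h2 : ∀ x : ℤ, (twistedInt (eta r s t u ε₁ ε₂)).ρ (a₂ r s t u) x = (ε₂ : ℤ) * x := fun x =>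
    congrArg (fun ε : ℤˣ => (ε : ℤ) * x) (eta_a₂ r s t u ε₁ ε₂)
  rw [h1, h2] at h
  exact h

theorem mem_coboundaries₂_iff (f : cocycles₂ (twistedInt (eta r s t u ε₁ ε₂))) :
    (f : G r s t u × G r s t u → ℤ) ∈ coboundaries₂ (twistedInt (eta r s t u ε₁ ε₂)) ↔
      ∃ α β γ, relatorTriple f = foxTriple r s t u ε₁ ε₂ α β γ := by
  refine (mem_coboundaries₂_iff_relatorHom f).trans ?_
  constructor
  · rintro ⟨v, hv⟩
    obtain ⟨h1, h2, h3⟩ := (forall_mem_rels r s t u).1 hv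
    refine ⟨v .a1, v .b1, v .a2, ?_⟩
    rw [← foxHom_rels]
    exact Prod.ext h1 (Prod.ext h2 h3)
  · rintro ⟨α, β, γ, h⟩
    have h' := h.trans (foxHom_rels (genValues α β γ)).symm
    exact ⟨genValues α β γ, (forall_mem_rels r s t u).2 ⟨congrArg Prod.fst h',
      congrArg (fun x => x.2.1) h', congrArg (fun x => x.2.2) h'⟩⟩

/-- Triples that are Fox derivatives over `ℚ` are relator values, up to integral Fox derivatives. -/
theorem exists_relatorTriple {n : ℤ} (hn : n ≠ 0) {α β γ : ℤ} {m : ℤ × ℤ × ℤ}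
    (h : foxTriple r s t u ε₁ ε₂ α β γ = n • m) :
    ∃ (f : cocycles₂ (twistedInt (eta r s t u ε₁ ε₂))) (α' β' γ' : ℤ),
      relatorTriple f = m + foxTriple r s t u ε₁ ε₂ α' β' γ' := by
  have hv := (foxHom_rels (genValues α β γ)).trans h
  have hv1 := congrArg Prod.fst hv
  have hv2 := congrArg (fun x => x.2.1) hv
  have hv3 := congrArg (fun x => x.2.2) hv
  obtain ⟨f, z, hf⟩ := exists_cocycle₂_of_dvd_foxHom (eta r s t u ε₁ ε₂) hn (genValues α β γ)
    ((forall_mem_rels r s t u).2 ⟨⟨_, hv1⟩, ⟨_, hv2⟩, ⟨_, hv3⟩⟩)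
  obtain ⟨h1, h2, h3⟩ := (forall_mem_rels r s t u).1 hf
  refine ⟨f, z .a1, z .b1, z .a2, ?_⟩
  rw [← foxHom_rels]
  refine Prod.ext (mul_left_cancel₀ hn ?_) (Prod.ext (mul_left_cancel₀ hn ?_)
    (mul_left_cancel₀ hn ?_))
  · exact h1.trans ((congrArg (· + _) hv1).trans (mul_add _ _ _).symm)
  · exact h2.trans ((congrArg (· + _) hv2).trans (mul_add _ _ _).symm)
  · exact h3.trans ((congrArg (· + _) hv3).trans (mul_add _ _ _).symm)

/-- The values of a 1-cocycle on the generators `a₁`, `b₁`, `a₂`. -/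
def generatorTriple : cocycles₁ (twistedInt (eta r s t u ε₁ ε₂)) →+ ℤ × ℤ × ℤ :=
  AddMonoidHom.mk' (fun c => (c (a₁ r s t u), c (b₁ r s t u), c (a₂ r s t u))) fun _ _ => rfl

theorem foxTriple_generatorTriple (c : cocycles₁ (twistedInt (eta r s t u ε₁ ε₂))) :
    foxTriple r s t u ε₁ ε₂ (generatorTriple c).1 (generatorTriple c).2.1
      (generatorTriple c).2.2 = 0 := by
  obtain ⟨h1, h2, h3⟩ := (forall_mem_rels r s t u).1 fun w hw =>
    foxHom_cocycle₁ c (PresentedGroup.one_of_mem hw)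
  refine (foxHom_rels fun x => c (PresentedGroup.of x)).symm.trans ?_
  exact Prod.ext h1 (Prod.ext h2 h3)

theorem exists_generatorTriple {α β γ : ℤ} (h : foxTriple r s t u ε₁ ε₂ α β γ = 0) :
    ∃ c : cocycles₁ (twistedInt (eta r s t u ε₁ ε₂)), generatorTriple c = (α, β, γ) := by
  have hv := (foxHom_rels (genValues α β γ)).trans h
  obtain ⟨c, hc⟩ := exists_cocycle₁ (A := twistedInt (eta r s t u ε₁ ε₂)) (genValues α β γ)
    ((forall_mem_rels r s t u).2 ⟨congrArg Prod.fst hv,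
      congrArg (fun x => x.2.1) hv, congrArg (fun x => x.2.2) hv⟩)
  exact ⟨c, Prod.ext (hc .a1) (Prod.ext (hc .b1) (hc .a2))⟩

/-- Coboundaries are detected on the generators. -/
theorem mem_coboundaries₁_iff (c : cocycles₁ (twistedInt (eta r s t u ε₁ ε₂))) :
    (c : G r s t u → ℤ) ∈ coboundaries₁ (twistedInt (eta r s t u ε₁ ε₂)) ↔
      ∃ x : ℤ, generatorTriple c = (ε₁ * x - x, 0, ε₂ * x - x) := by
  have key : ∀ x : ℤ, generatorTriple (⟨_, d₀₁_apply_mem_cocycles₁ (A := twistedInt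
      (eta r s t u ε₁ ε₂)) x⟩ : cocycles₁ (twistedInt (eta r s t u ε₁ ε₂))) =
      (ε₁ * x - x, 0, ε₂ * x - x) := fun x => by
    refine Prod.ext ?_ (Prod.ext ?_ ?_)
    · exact congrArg (fun ε : ℤˣ => (ε : ℤ) * x - x) (eta_a₁ r s t u ε₁ ε₂)
    · exact (congrArg (fun ε : ℤˣ => (ε : ℤ) * x - x) (eta_b₁ r s t u ε₁ ε₂)).trans (by simp)
    · exact congrArg (fun ε : ℤˣ => (ε : ℤ) * x - x) (eta_a₂ r s t u ε₁ ε₂)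
  constructor
  · rintro ⟨x, hx⟩
    refine ⟨x, (congrArg generatorTriple (Subtype.ext hx.symm)).trans (key x)⟩
  · rintro ⟨x, hx⟩
    have h := hx.trans (key x).symm
    have hc : c = ⟨_, d₀₁_apply_mem_cocycles₁ (A := twistedInt (eta r s t u ε₁ ε₂)) x⟩ := by
      refine cocycles₁_ext_of fun i => ?_
      cases i
      exacts [congrArg Prod.fst h, congrArg (fun x => x.2.1) h, congrArg (fun x => x.2.2) h]
    exact ⟨x, (congrArg Subtype.val hc).symm⟩

end SignCoefficients

/-! ### A class of infinite order -/

section Determinant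

/-- The determinant of two vectors of `ℤ²`. -/
def vecDet (x y : Fin 2 → ℤ) : ℤ := x 0 * y 1 - x 1 * y 0

theorem vecDet_mulVec (M : Matrix (Fin 2) (Fin 2) ℤ) (x y : Fin 2 → ℤ) :
    vecDet (M.mulVec x) (M.mulVec y) = M.det * vecDet x y := by
  simp [vecDet, Matrix.mulVec, dotProduct, Fin.sum_univ_two, Matrix.det_fin_two]
  ring

theorem vecDet_add_left (x y z : Fin 2 → ℤ) : vecDet (x + y) z = vecDet x z + vecDet y z := by
  simp only [vecDet, Pi.add_apply]
  ring

theorem vecDet_add_right (x y z : Fin 2 → ℤ) : vecDet x (y + z) = vecDet x y + vecDet x z := by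
  simp only [vecDet, Pi.add_apply]
  ring

variable (r s t u : ℤ)

/-- The action of `a₁` by conjugation on the fibre group `ℤ²`, in the basis `a₁², b₁`. -/
def fibreMatrix₁ : Matrix (Fin 2) (Fin 2) ℤ := !![1, 0; 0, -1]

/-- The action of `a₂` by conjugation on the fibre group `ℤ²`, in the basis `a₁², b₁`: it fixes
`(r, s)` and negates `(t, u)`. The factor `ru - st = ±1` is the inverse of the determinant of
this basis. -/
def fibreMatrix₂ : Matrix (Fin 2) (Fin 2) ℤ :=
  (r * u - s * t) • !![r * u + s * t, -(2 * r * t); 2 * s * u, -(r * u + s * t)]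

theorem fibreMatrix₁_mulVec (x y : ℤ) : fibreMatrix₁.mulVec ![x, y] = ![x, -y] := by
  ext i
  fin_cases i <;> simp [fibreMatrix₁, Matrix.mulVec, dotProduct, Fin.sum_univ_two]

theorem fibreMatrix₂_mulVec (x y : ℤ) : (fibreMatrix₂ r s t u).mulVec ![x, y] =
    ![(r * u - s * t) * ((r * u + s * t) * x - 2 * r * t * y),
      (r * u - s * t) * (2 * s * u * x - (r * u + s * t) * y)] := by
  ext i
  fin_cases i <;> simp [fibreMatrix₂, Matrix.mulVec, dotProduct, Fin.sum_univ_two] <;> ring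

/-- The values on the generators of the crossed homomorphism to `ℤ²` that is twice the inclusion on
the fibre group. -/
def fibreValues : SapphireGen → Fin 2 → ℤ
  | .a1 => ![1, 0]
  | .b1 => ![0, 2]
  | .a2 => ![r, s]

theorem fibreMatrix₁_sq : fibreMatrix₁ * fibreMatrix₁ = 1 := by
  ext i j
  fin_cases i <;> fin_cases j <;> simp [fibreMatrix₁, Matrix.mul_apply, Fin.sum_univ_two]

variable {r s t u} (hdet : (r * u - s * t) * (r * u - s * t) = 1)
include hdet

theorem fibreMatrix₂_sq : fibreMatrix₂ r s t u * fibreMatrix₂ r s t u = 1 := by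
  ext i j
  fin_cases i <;> fin_cases j <;>
    simp [fibreMatrix₂, Matrix.mul_apply, Fin.sum_univ_two]
  · linear_combination ((r * u - s * t) * (r * u - s * t) + 1) * hdet
  · ring
  · ring
  · linear_combination ((r * u - s * t) * (r * u - s * t) + 1) * hdet

/-- The images of the generators under the action by conjugation on the fibre group. -/
def fibreGen : SapphireGen → GL (Fin 2) ℤ
  | .a1 => ⟨fibreMatrix₁, fibreMatrix₁, fibreMatrix₁_sq, fibreMatrix₁_sq⟩
  | .b1 => 1
  | .a2 => ⟨fibreMatrix₂ r s t u, fibreMatrix₂ r s t u, fibreMatrix₂_sq hdet, fibreMatrix₂_sq hdet⟩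

theorem fibreGen_sq (x : SapphireGen) : fibreGen hdet x ^ 2 = 1 := by
  rw [pow_two]
  cases x
  · exact Units.ext fibreMatrix₁_sq
  · exact one_mul 1
  · exact Units.ext (fibreMatrix₂_sq hdet)

/-- The action of the group by conjugation on the fibre group `ℤ²`. -/
def fibreAction : G r s t u →* GL (Fin 2) ℤ :=
  PresentedGroup.toGroup (f := fibreGen hdet) <| by
    have hb : fibreGen hdet .b1 = 1 := rfl
    have h := fibreGen_sq hdet
    refine (forall_mem_rels r s t u).2 ⟨?_, ?_, ?_⟩
    · simp [rel₁, hb]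
    · simp [rel₂, hb, zpow_mul, h]
    · simp [rel₃, hb, zpow_mul, h]

theorem fibreAction_of (x : SapphireGen) :
    fibreAction hdet (PresentedGroup.of x) = fibreGen hdet x :=
  PresentedGroup.toGroup.of _

theorem det_fibreAction (g : G r s t u) :
    (fibreAction hdet g).1.det = ((eta r s t u (-1) (-1) g : ℤˣ) : ℤ) := by
  have : Matrix.GeneralLinearGroup.det.comp (fibreAction hdet) = eta r s t u (-1) (-1) := by
    ext x
    rw [MonoidHom.comp_apply, fibreAction_of]
    cases x
    · refine Eq.trans ?_ (congrArg Units.val (eta_a₁ r s t u (-1) (-1)).symm)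
      change fibreMatrix₁.det = -1
      simp [fibreMatrix₁]
    · refine Eq.trans ?_ (congrArg Units.val (eta_b₁ r s t u (-1) (-1)).symm)
      change (1 : Matrix (Fin 2) (Fin 2) ℤ).det = 1
      simp
    · refine Eq.trans ?_ (congrArg Units.val (eta_a₂ r s t u (-1) (-1)).symm)
      change (fibreMatrix₂ r s t u).det = -1
      simp [fibreMatrix₂, Matrix.det_fin_two]
      linear_combination (-(r * u - s * t) * (r * u - s * t) - 1) * hdet
  exact congrArg Units.val (DFunLike.congr_fun this g)

/-- The fibre group `ℤ²` as a module over the group, by conjugation. -/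
abbrev fibreRep : Rep ℤ (G r s t u) :=
  Rep.of (X := Fin 2 → ℤ) (Matrix.toLinAlgEquiv'.toMonoidHom.comp
    ((Units.coeHom _).comp (fibreAction hdet)))

theorem fibreRep_apply (g : G r s t u) (x : Fin 2 → ℤ) :
    (fibreRep hdet).ρ g x = (fibreAction hdet g).1.mulVec x := rfl

theorem fibreRep_a₁ (x : Fin 2 → ℤ) :
    (fibreRep hdet).ρ (a₁ r s t u) x = fibreMatrix₁.mulVec x := by
  rw [fibreRep_apply, a₁, fibreAction_of]
  rfl

theorem fibreRep_b₁ (x : Fin 2 → ℤ) : (fibreRep hdet).ρ (b₁ r s t u) x = x := by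
  rw [fibreRep_apply, b₁, fibreAction_of]
  exact Matrix.one_mulVec x

theorem fibreRep_a₂ (x : Fin 2 → ℤ) :
    (fibreRep hdet).ρ (a₂ r s t u) x = (fibreMatrix₂ r s t u).mulVec x := by
  rw [fibreRep_apply, a₂, fibreAction_of]
  rfl

theorem factorsThroughDihedral_fibreRep : FactorsThroughDihedral (fibreRep hdet) := by
  refine ⟨LinearMap.ext fun x => ?_, LinearMap.ext fun x => ?_, LinearMap.ext fun x => ?_⟩
  · exact fibreRep_b₁ hdet x
  · rw [Module.End.mul_apply, fibreRep_a₁, fibreRep_a₁, Matrix.mulVec_mulVec, fibreMatrix₁_sq]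
    exact Matrix.one_mulVec x
  · rw [Module.End.mul_apply, fibreRep_a₂, fibreRep_a₂, Matrix.mulVec_mulVec, fibreMatrix₂_sq hdet]
    exact Matrix.one_mulVec x

/-- The group has a crossed homomorphism to its fibre group `ℤ²` that is multiplication by `2` on
this fibre group. -/
theorem exists_fibreCocycle :
    ∃ c : cocycles₁ (fibreRep hdet), ∀ x, c (PresentedGroup.of x) = fibreValues r s x := by
  have hA := factorsThroughDihedral_fibreRep hdet
  refine exists_cocycle₁ (A := fibreRep hdet) (fibreValues r s)
    ((forall_mem_rels r s t u).2 ⟨?_, ?_, ?_⟩)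
  · rw [foxHom_rel₁ hA, fibreRep_a₁]
    change ![0, 2] + fibreMatrix₁.mulVec ![0, 2] = 0
    rw [fibreMatrix₁_mulVec]
    simp
  · rw [foxHom_rel₂ hA, fibreRep_a₁, fibreRep_a₂]
    change ![r, s] + (fibreMatrix₂ r s t u).mulVec ![r, s] -
      (r • (![1, 0] + fibreMatrix₁.mulVec ![1, 0]) + s • ![0, 2]) = 0
    rw [fibreMatrix₁_mulVec, fibreMatrix₂_mulVec]
    ext i
    change _ = (0 : ℤ)
    fin_cases i <;> simp
    · linear_combination r * hdet
    · linear_combination s * hdet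
  · rw [foxHom_rel₃ hA, fibreRep_a₁, fibreRep_a₂]
    have h : t • (fibreValues r s .a1 + fibreMatrix₁.mulVec (fibreValues r s .a1)) +
        u • fibreValues r s .b1 = ![2 * t, 2 * u] := by
      change t • (![1, 0] + fibreMatrix₁.mulVec ![1, 0]) + u • ![0, 2] = _
      rw [fibreMatrix₁_mulVec]
      ext i
      fin_cases i <;> simp <;> ring
    refine (congrArg (fun x => x + (fibreMatrix₂ r s t u).mulVec x) h).trans ?_
    rw [fibreMatrix₂_mulVec]
    ext i
    change _ = (0 : ℤ)
    fin_cases i <;> simp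
    · linear_combination -2 * t * hdet
    · linear_combination -2 * u * hdet

/-- A class of infinite order for the character by which the group acts on the orientation of the
fibre: the cup square of
the crossed homomorphism to `ℤ²`, paired by the determinant. -/
theorem exists_relatorTriple_fst_ne_zero :
    ∃ f : cocycles₂ (twistedInt (eta r s t u (-1) (-1))), (relatorTriple f).1 ≠ 0 := by
  obtain ⟨c, hc⟩ := exists_fibreCocycle hdet
  let φ : G r s t u → Fin 2 → ℤ := c
  let M : G r s t u → Matrix (Fin 2) (Fin 2) ℤ := fun g => (fibreAction hdet g).1
  have hφ : ∀ g h, φ (g * h) = (M g).mulVec (φ h) + φ g := (mem_cocycles₁_iff c).1 c.2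
  have hM : ∀ g h, M (g * h) = M g * M h := fun g h => by simp [M]
  let F : G r s t u × G r s t u → ℤ := fun p => vecDet (φ p.1) ((M p.1).mulVec (φ p.2))
  have hF : F ∈ cocycles₂ (twistedInt (eta r s t u (-1) (-1))) :=
    (mem_cocycles₂_iff _).2 fun g h j => by
      change vecDet (φ (g * h)) ((M (g * h)).mulVec (φ j)) + vecDet (φ g) ((M g).mulVec (φ h)) =
        ((eta r s t u (-1) (-1) g : ℤˣ) : ℤ) * vecDet (φ h) ((M h).mulVec (φ j)) +
          vecDet (φ g) ((M g).mulVec (φ (h * j)))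
      rw [← det_fibreAction hdet, ← vecDet_mulVec, hφ, hφ, hM, ← Matrix.mulVec_mulVec,
        Matrix.mulVec_add, vecDet_add_left, vecDet_add_right]
      change _ = vecDet ((M g).mulVec (φ h)) ((M g).mulVec _) + _
      ring
  let f : cocycles₂ (twistedInt (eta r s t u (-1) (-1))) := ⟨F, hF⟩
  refine ⟨f, ?_⟩
  change (relatorHom rel₁ f : ℤ) ≠ 0
  have h1 := freeLift_eq_incl f 0 (PresentedGroup.one_of_mem (.inl rfl : rel₁ ∈ rels r s t u))
  change freeLift f 0 rel₁ = CocycleExtension.incl f (relatorHom rel₁ f) at h1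
  generalize relatorHom rel₁ f = p at h1 ⊢
  simp only [rel₁, map_mul, map_inv, freeLift_of, Pi.zero_apply] at h1
  set a : CocycleExtension f := ⟨0, a₁ r s t u⟩
  set b : CocycleExtension f := ⟨0, b₁ r s t u⟩
  change a * b * a⁻¹ * (b⁻¹)⁻¹ = _ at h1
  have hbp : b * CocycleExtension.incl f p = CocycleExtension.incl f p * b := by
    rw [CocycleExtension.mul_incl]
    congr 2
    exact LinearMap.congr_fun factorsThroughDihedral_twistedInt.b₁ p
  -- The relation `a b a⁻¹ b = p` in a form without inverses, to be compared in coordinates.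
  have h2 : b * a * b = CocycleExtension.incl f p * a := by
    calc b * a * b = b * (a * b * a⁻¹ * (b⁻¹)⁻¹) * b⁻¹ * a := by group
      _ = _ := by rw [h1, hbp]; group
  have h3 := congrArg CocycleExtension.left h2
  have hφ1 : φ 1 = 0 := cocycles₁_map_one c
  have hF1 : ∀ g, F (1, g) = 0 := fun g => by
    change vecDet (φ 1) _ = 0
    rw [hφ1]
    simp [vecDet]
  have hφa : φ (a₁ r s t u) = ![1, 0] := hc .a1
  have hφb : φ (b₁ r s t u) = ![0, 2] := hc .b1
  have hMa : M (a₁ r s t u) = fibreMatrix₁ :=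
    congrArg Units.val (fibreAction_of hdet SapphireGen.a1)
  have hMb : M (b₁ r s t u) = 1 := congrArg Units.val (fibreAction_of hdet SapphireGen.b1)
  have hl : F (b₁ r s t u, a₁ r s t u) = -2 := by
    change vecDet (φ _) ((M _).mulVec (φ _)) = _
    rw [hφa, hφb, hMb, Matrix.one_mulVec]
    simp [vecDet]
  have hr : F (b₁ r s t u * a₁ r s t u, b₁ r s t u) = -2 := by
    change vecDet (φ _) ((M _).mulVec (φ _)) = _
    rw [hφ, hM, hφa, hφb, hMa, hMb, Matrix.one_mulVec, one_mul, fibreMatrix₁_mulVec]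
    simp [vecDet]
  have h4 : (p : ℤ) = -4 := by
    simp only [CocycleExtension.mul_left, CocycleExtension.mul_right, CocycleExtension.incl, a, b,
      map_zero, add_zero, zero_add] at h3
    change F (b₁ r s t u, a₁ r s t u) + F (b₁ r s t u * a₁ r s t u, b₁ r s t u) =
      p - F (1, 1) + F (1, a₁ r s t u) at h3
    rw [hl, hr, hF1, hF1, sub_zero, add_zero] at h3
    exact h3.symm
  exact ne_of_eq_of_ne h4 (by decide : (-4 : ℤ) ≠ 0)

end Determinant

/-! ### The cohomology groups -/

section Computation

variable {r s t u : ℤ}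

theorem nonempty_H1_trivial_neg (hr : r ≠ 0) :
    Nonempty (groupCohomology (twistedInt (eta r s t u 1 (-1))) 1 ≃+ ZMod 2) := by
  let φ : cocycles₁ (twistedInt (eta r s t u 1 (-1))) →+ ZMod 2 := (Int.castAddHom _).comp
    ((AddMonoidHom.snd _ _).comp ((AddMonoidHom.snd _ _).comp generatorTriple))
  have hφ : ∀ c, φ c = ((generatorTriple c).2.2 : ℤ) := fun _ => rfl
  refine nonempty_H1_addEquiv φ (fun y => ?_) fun c => ?_
  · obtain ⟨y, rfl⟩ := ZMod.intCast_surjective y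
    obtain ⟨c, hc⟩ := exists_generatorTriple (r := r) (s := s) (t := t) (u := u) (ε₁ := 1)
      (ε₂ := -1) (α := 0) (β := 0) (γ := y) (by simp [foxTriple])
    exact ⟨c, by rw [hφ, hc]⟩
  · have h := foxTriple_generatorTriple c
    rw [mem_coboundaries₁_iff, hφ]
    generalize generatorTriple c = g at h ⊢
    obtain ⟨α, β, γ⟩ := g
    simp only [foxTriple, Prod.mk.injEq, Prod.zero_eq_mk, Units.val_one, Units.val_neg] at h ⊢
    obtain ⟨h1, h2, -⟩ := h
    obtain rfl : β = 0 := by linarith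
    have hα : r * α = 0 := by linarith
    obtain rfl : α = 0 := (mul_eq_zero.1 hα).resolve_left hr
    rw [ZMod.intCast_zmod_eq_zero_iff_dvd]
    constructor
    · rintro ⟨x, hx⟩
      exact ⟨-x, by ring, rfl, by push_cast at hx; rw [hx]; ring⟩
    · rintro ⟨x, -, -, hx⟩
      exact ⟨-x, by rw [hx]; push_cast; ring⟩

theorem nonempty_H1_neg_trivial (hu : u ≠ 0) :
    Nonempty (groupCohomology (twistedInt (eta r s t u (-1) 1)) 1 ≃+ ZMod 2) := by
  let φ : cocycles₁ (twistedInt (eta r s t u (-1) 1)) →+ ZMod 2 := (Int.castAddHom _).comp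
    ((AddMonoidHom.fst _ _).comp generatorTriple)
  have hφ : ∀ c, φ c = ((generatorTriple c).1 : ℤ) := fun _ => rfl
  refine nonempty_H1_addEquiv φ (fun y => ?_) fun c => ?_
  · obtain ⟨y, rfl⟩ := ZMod.intCast_surjective y
    obtain ⟨c, hc⟩ := exists_generatorTriple (r := r) (s := s) (t := t) (u := u) (ε₁ := -1)
      (ε₂ := 1) (α := y) (β := 0) (γ := 0) (by simp [foxTriple])
    exact ⟨c, by rw [hφ, hc]⟩
  · have h := foxTriple_generatorTriple c
    rw [mem_coboundaries₁_iff, hφ]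
    generalize generatorTriple c = g at h ⊢
    obtain ⟨α, β, γ⟩ := g
    simp only [foxTriple, Prod.mk.injEq, Prod.zero_eq_mk, Units.val_one, Units.val_neg] at h ⊢
    obtain ⟨-, h2, h3⟩ := h
    have hβ : u * β = 0 := by linarith
    obtain rfl : β = 0 := (mul_eq_zero.1 hβ).resolve_left hu
    obtain rfl : γ = 0 := by linarith
    rw [ZMod.intCast_zmod_eq_zero_iff_dvd]
    constructor
    · rintro ⟨x, hx⟩
      exact ⟨-x, by push_cast at hx; rw [hx]; ring, rfl, by ring⟩
    · rintro ⟨x, hx, -, -⟩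
      exact ⟨-x, by rw [hx]; push_cast; ring⟩

theorem nonempty_H1_neg_neg (hs : s ≠ 0) :
    Nonempty (groupCohomology (twistedInt (eta r s t u (-1) (-1))) 1 ≃+ ℤ × ZMod 2) := by
  let φ : cocycles₁ (twistedInt (eta r s t u (-1) (-1))) →+ ℤ × ZMod 2 := AddMonoidHom.prod
    ((AddMonoidHom.fst _ _).comp generatorTriple -
      (AddMonoidHom.snd _ _).comp ((AddMonoidHom.snd _ _).comp generatorTriple))
    ((Int.castAddHom _).comp ((AddMonoidHom.fst _ _).comp generatorTriple))
  have hφ : ∀ c, φ c = ((generatorTriple c).1 - (generatorTriple c).2.2,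
    (((generatorTriple c).1 : ℤ) : ZMod 2)) := fun _ => rfl
  refine nonempty_H1_addEquiv φ (fun ⟨x, y⟩ => ?_) fun c => ?_
  · obtain ⟨y, rfl⟩ := ZMod.intCast_surjective y
    obtain ⟨c, hc⟩ := exists_generatorTriple (r := r) (s := s) (t := t) (u := u) (ε₁ := -1)
      (ε₂ := -1) (α := y) (β := 0) (γ := y - x) (by simp [foxTriple])
    exact ⟨c, by rw [hφ, hc, sub_sub_cancel]⟩
  · have h := foxTriple_generatorTriple c
    rw [mem_coboundaries₁_iff, hφ]
    generalize generatorTriple c = g at h ⊢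
    obtain ⟨α, β, γ⟩ := g
    simp only [foxTriple, Prod.mk.injEq, Prod.zero_eq_mk, Units.val_one, Units.val_neg] at h ⊢
    obtain ⟨-, h2, -⟩ := h
    have hβ : s * β = 0 := by linarith
    obtain rfl : β = 0 := (mul_eq_zero.1 hβ).resolve_left hs
    rw [ZMod.intCast_zmod_eq_zero_iff_dvd]
    constructor
    · rintro ⟨h, x, hx⟩
      push_cast at hx
      exact ⟨-x, by rw [hx]; ring, rfl, by linarith⟩
    · rintro ⟨x, hx, -, hx'⟩
      exact ⟨by linarith, -x, by rw [hx]; push_cast; ring⟩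

/-- The reduction modulo `n` of an integral linear form on `ℤ³`. -/
def modForm (n a b c : ℤ) : ℤ × ℤ × ℤ →+ ZMod n.natAbs :=
  (Int.castAddHom _).comp (AddMonoidHom.mk' (fun m => a * m.1 + b * m.2.1 + c * m.2.2)
    fun m m' => by
      simp only [Prod.fst_add, Prod.snd_add]
      ring)

theorem modForm_apply (n a b c : ℤ) (m : ℤ × ℤ × ℤ) :
    modForm n a b c m = ((a * m.1 + b * m.2.1 + c * m.2.2 : ℤ) : ZMod n.natAbs) := rfl

theorem modForm_eq_intCast {n a b c x : ℤ} {m : ℤ × ℤ × ℤ}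
    (h : a * m.1 + b * m.2.1 + c * m.2.2 = x) : modForm n a b c m = (x : ZMod n.natAbs) := by
  rw [modForm_apply, h]

theorem modForm_eq_zero_iff {n a b c : ℤ} {m : ℤ × ℤ × ℤ} :
    modForm n a b c m = 0 ↔ n ∣ a * m.1 + b * m.2.1 + c * m.2.2 :=
  intCast_zmod_natAbs_eq_zero_iff n _

/-- If `H²` is torsion, it is computed by a homomorphism on `ℤ³` whose kernel, on the triples that
satisfy the identity among the relations, consists of the Fox derivatives. -/
theorem nonempty_H2_addEquiv_of_relatorTriple {ε₁ ε₂ : ℤˣ} {Q : Type} [AddCommGroup Q]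
    (L : ℤ × ℤ × ℤ →+ Q) (hfox : ∀ α β γ, L (foxTriple r s t u ε₁ ε₂ α β γ) = 0)
    (hker : ∀ p q w, ε₂ * w - w = (r * u - s * t) * (ε₁ * p - p) → L (p, q, w) = 0 →
      ∃ α β γ, (p, q, w) = foxTriple r s t u ε₁ ε₂ α β γ)
    (hsurj : ∀ y, ∃ n : ℤ, n ≠ 0 ∧ ∃ α β γ m,
      foxTriple r s t u ε₁ ε₂ α β γ = n • m ∧ L m = y) :
    Nonempty (groupCohomology (twistedInt (eta r s t u ε₁ ε₂)) 2 ≃+ Q) := by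
  refine nonempty_H2_addEquiv (L.comp relatorTriple) (fun y => ?_) fun f => ?_
  · obtain ⟨n, hn, α, β, γ, m, hm, rfl⟩ := hsurj y
    obtain ⟨f, α', β', γ', hf⟩ := exists_relatorTriple hn hm
    refine ⟨f, ?_⟩
    rw [AddMonoidHom.comp_apply, hf, map_add, hfox, add_zero]
  · rw [mem_coboundaries₂_iff, AddMonoidHom.comp_apply]
    constructor
    · exact hker _ _ _ (relatorTriple_identity f)
    · rintro ⟨α, β, γ, h⟩
      rw [h, hfox]

theorem nonempty_H2_trivial_neg_of_even (hr : r ≠ 0) (hs : Even s) :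
    Nonempty (groupCohomology (twistedInt (eta r s t u 1 (-1))) 2 ≃+
      ZMod (2 * r).natAbs × ZMod 2) := by
  obtain ⟨k, rfl⟩ := hs.two_dvd
  refine nonempty_H2_addEquiv_of_relatorTriple
    ((modForm (2 * r) k 1 0).prod (modForm 2 1 0 0)) (fun α β γ => Prod.ext ?_ ?_)
    (fun p q w h hL => ?_) (fun ⟨x, y⟩ => ?_)
  · exact modForm_eq_zero_iff.2 ⟨-α, by simp [foxTriple]; ring⟩
  · exact modForm_eq_zero_iff.2 ⟨β, by simp [foxTriple]; ring⟩
  · obtain ⟨x, hx⟩ := modForm_eq_zero_iff.1 (congrArg Prod.fst hL)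
    obtain ⟨y, hy⟩ := modForm_eq_zero_iff.1 (congrArg Prod.snd hL)
    simp only [Units.val_one, Units.val_neg] at h hx hy
    refine ⟨-x, y, 0, ?_⟩
    simp only [foxTriple, Prod.mk.injEq, Units.val_one, Units.val_neg]
    exact ⟨by linarith, by linear_combination hx - k * hy, by linarith⟩
  · obtain ⟨x, rfl⟩ := ZMod.intCast_surjective x
    obtain ⟨y, rfl⟩ := ZMod.intCast_surjective y
    refine ⟨2 * r, mul_ne_zero two_ne_zero hr, -x, r * y, 0, (y, x - k * y, 0), ?_, ?_⟩
    · simp only [foxTriple, Prod.smul_mk, Prod.mk.injEq, smul_eq_mul, Units.val_one, Units.val_neg]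
      exact ⟨by ring, by ring, by ring⟩
    · exact Prod.ext (modForm_eq_intCast (by ring)) (modForm_eq_intCast (by ring))

theorem nonempty_H2_trivial_neg_of_odd (hr : r ≠ 0) (hs : Odd s) :
    Nonempty (groupCohomology (twistedInt (eta r s t u 1 (-1))) 2 ≃+ ZMod (4 * r).natAbs) := by
  obtain ⟨k, rfl⟩ := hs
  refine nonempty_H2_addEquiv_of_relatorTriple
    (modForm (4 * r) (2 * k + 1) 2 0) (fun α β γ => ?_)
    (fun p q w h hL => ?_) (fun x => ?_)
  · exact modForm_eq_zero_iff.2 ⟨-α, by simp [foxTriple]; ring⟩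
  · obtain ⟨x, hx⟩ := modForm_eq_zero_iff.1 hL
    simp only [Units.val_one, Units.val_neg] at h hx
    -- The form is odd in `p` and even in `q`, so that `p` is even: the second value is `p / 2`.
    refine ⟨-x, 2 * r * x - q - k * p, 0, ?_⟩
    simp only [foxTriple, Prod.mk.injEq, Units.val_one, Units.val_neg]
    refine ⟨by linear_combination hx, ?_, by linarith⟩
    have hp : p = 2 * (2 * r * x - q - k * p) := by linear_combination hx
    linear_combination (-k) * hp
  · obtain ⟨x, rfl⟩ := ZMod.intCast_surjective x
    refine ⟨4 * r, mul_ne_zero four_ne_zero hr, -x, 2 * r * x, 0, (x, -k * x, 0), ?_, ?_⟩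
    · simp only [foxTriple, Prod.smul_mk, Prod.mk.injEq, smul_eq_mul, Units.val_one, Units.val_neg]
      exact ⟨by ring, by ring, by ring⟩
    · exact modForm_eq_intCast (by ring)

theorem nonempty_H2_neg_trivial_of_even (hdet : r * u - s * t ≠ 0) (hu : u ≠ 0) (hs : Even s) :
    Nonempty (groupCohomology (twistedInt (eta r s t u (-1) 1)) 2 ≃+
      ZMod (2 * u).natAbs × ZMod 2) := by
  obtain ⟨k, rfl⟩ := hs.two_dvd
  refine nonempty_H2_addEquiv_of_relatorTriple
    ((modForm (2 * u) 0 0 1).prod (modForm 2 0 1 0)) (fun α β γ => Prod.ext ?_ ?_)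
    (fun p q w h hL => ?_) (fun ⟨x, y⟩ => ?_)
  · exact modForm_eq_zero_iff.2 ⟨β, by simp [foxTriple]; ring⟩
  · exact modForm_eq_zero_iff.2 ⟨γ - k * β, by simp [foxTriple]; ring⟩
  · obtain ⟨x, hx⟩ := modForm_eq_zero_iff.1 (congrArg Prod.fst hL)
    obtain ⟨y, hy⟩ := modForm_eq_zero_iff.1 (congrArg Prod.snd hL)
    simp only [Units.val_one, Units.val_neg] at h hx hy
    have hp : p = 0 := (mul_eq_zero.1 (by linarith : (r * u - 2 * k * t) * p = 0)).resolve_left hdet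
    refine ⟨0, x, y + k * x, ?_⟩
    simp only [foxTriple, Prod.mk.injEq, Units.val_one, Units.val_neg]
    exact ⟨by linarith, by linear_combination hy, by linear_combination hx⟩
  · obtain ⟨x, rfl⟩ := ZMod.intCast_surjective x
    obtain ⟨y, rfl⟩ := ZMod.intCast_surjective y
    refine ⟨2 * u, mul_ne_zero two_ne_zero hu, 0, x, u * y + k * x, (0, y, x), ?_, ?_⟩
    · simp only [foxTriple, Prod.smul_mk, Prod.mk.injEq, smul_eq_mul, Units.val_one, Units.val_neg]
      exact ⟨by ring, by ring, by ring⟩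
    · exact Prod.ext (modForm_eq_intCast (by ring)) (modForm_eq_intCast (by ring))

theorem nonempty_H2_neg_trivial_of_odd (hdet : r * u - s * t ≠ 0) (hu : u ≠ 0) (hs : Odd s) :
    Nonempty (groupCohomology (twistedInt (eta r s t u (-1) 1)) 2 ≃+ ZMod (4 * u).natAbs) := by
  obtain ⟨k, rfl⟩ := hs
  refine nonempty_H2_addEquiv_of_relatorTriple
    (modForm (4 * u) 0 (-(2 * u)) 1) (fun α β γ => ?_)
    (fun p q w h hL => ?_) (fun x => ?_)
  · exact modForm_eq_zero_iff.2 ⟨(k + 1) * β - γ, by simp [foxTriple]; ring⟩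
  · obtain ⟨x, hx⟩ := modForm_eq_zero_iff.1 hL
    simp only [Units.val_one, Units.val_neg] at h hx
    have hp : p = 0 :=
      (mul_eq_zero.1 (by linarith : (r * u - (2 * k + 1) * t) * p = 0)).resolve_left hdet
    refine ⟨0, q + 2 * x, (k + 1) * q + (2 * k + 1) * x, ?_⟩
    simp only [foxTriple, Prod.mk.injEq, Units.val_one, Units.val_neg]
    exact ⟨by linarith, by ring, by linear_combination hx⟩
  · obtain ⟨x, rfl⟩ := ZMod.intCast_surjective x
    refine ⟨4 * u, mul_ne_zero four_ne_zero hu, 0, 2 * x, (2 * k + 1) * x, (0, 0, x), ?_, ?_⟩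
    · simp only [foxTriple, Prod.smul_mk, Prod.mk.injEq, smul_eq_mul, Units.val_one, Units.val_neg]
      exact ⟨by ring, by ring, by ring⟩
    · exact modForm_eq_intCast (by ring)

theorem nonempty_H2_neg_neg (hdet : (r * u - s * t) * (r * u - s * t) = 1) (hs : s ≠ 0) :
    Nonempty (groupCohomology (twistedInt (eta r s t u (-1) (-1))) 2 ≃+ ℤ × ZMod s.natAbs) := by
  let T := relatorTriple (r := r) (s := s) (t := t) (u := u) (ε₁ := -1) (ε₂ := -1)
  let P := (AddMonoidHom.fst _ _).comp T
  have hT : ∀ f, T f = ((P f, (T f).2.1, (r * u - s * t) * P f) : ℤ × ℤ × ℤ) := fun f => by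
    have h := relatorTriple_identity f
    change _ * (T f).2.2 - (T f).2.2 = _ * (_ * P f - P f) at h
    refine Prod.ext rfl (Prod.ext rfl ?_)
    simp only [Units.val_neg, Units.val_one] at h
    linarith
  -- The first relator value takes the values `d ℤ` for some `d ≠ 0`.
  obtain ⟨d, hd⟩ := Int.subgroup_cyclic P.range
  have hd0 : d ≠ 0 := by
    rintro rfl
    obtain ⟨f, hf⟩ := exists_relatorTriple_fst_ne_zero hdet
    have : P f ∈ P.range := ⟨f, rfl⟩
    rw [hd] at this
    exact hf (AddSubgroup.closure_singleton_zero.le this)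
  have hdvd : ∀ f, ∃ x, P f = d * x := fun f => by
    have : P f ∈ P.range := ⟨f, rfl⟩
    rw [hd, AddSubgroup.mem_closure_singleton] at this
    obtain ⟨x, hx⟩ := this
    exact ⟨x, by rw [← hx, smul_eq_mul, mul_comm]⟩
  choose e he using hdvd
  let e' : cocycles₂ (twistedInt (eta r s t u (-1) (-1))) →+ ℤ := AddMonoidHom.mk' e fun f f' => by
    refine mul_left_cancel₀ hd0 ?_
    rw [mul_add, ← he, ← he, ← he, map_add]
  let φ := e'.prod ((modForm s 0 1 0).comp T)
  have hfox : ∀ α β γ : ℤ, foxTriple r s t u (-1) (-1) α β γ = (0, -(s * β), 0) := fun α β γ => by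
    simp [foxTriple]
  refine nonempty_H2_addEquiv φ (fun ⟨x, y⟩ => ?_) fun f => ?_
  · obtain ⟨f, hf⟩ : ∃ f, P f = d := by
      have : d ∈ P.range := hd ▸ AddSubgroup.subset_closure rfl
      exact this
    obtain ⟨y, rfl⟩ := ZMod.intCast_surjective y
    obtain ⟨g, α, β, γ, hg⟩ := exists_relatorTriple (r := r) (s := s) (t := t) (u := u)
      (ε₁ := -1) (ε₂ := -1) hs (α := 0) (β := -(y - x * (T f).2.1)) (γ := 0)
      (m := (0, y - x * (T f).2.1, 0)) (by
        rw [hfox, Prod.smul_mk, Prod.smul_mk, smul_zero, smul_eq_mul, mul_neg, neg_neg])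
    have hg' : T g = (0, y - x * (T f).2.1 - s * β, 0) := by
      refine hg.trans ?_
      rw [hfox]
      simp [sub_eq_add_neg]
    have hx : T (x • f + g) = (x * d, y - s * β, (r * u - s * t) * (x * d)) := by
      rw [map_add, map_zsmul, hg', hT f, hf]
      simp only [Prod.smul_mk, Prod.mk_add_mk, smul_eq_mul, Prod.mk.injEq]
      exact ⟨by ring, by ring, by ring⟩
    refine ⟨x • f + g, Prod.ext (mul_left_cancel₀ hd0 ?_) ?_⟩
    · refine (he _).symm.trans ?_
      change (T (x • f + g)).1 = _
      rw [hx, mul_comm]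
    · change modForm s 0 1 0 (T (x • f + g)) = _
      rw [hx, modForm_apply, ← sub_eq_zero, ← Int.cast_sub, intCast_zmod_natAbs_eq_zero_iff]
      exact ⟨-β, by ring⟩
  · rw [mem_coboundaries₂_iff]
    change φ f = 0 ↔ ∃ α β γ, T f = _
    constructor
    · intro h
      have h1 : e f = 0 := congrArg Prod.fst h
      obtain ⟨x, hx⟩ := modForm_eq_zero_iff.1 (congrArg Prod.snd h)
      have hP : P f = 0 := by rw [he, h1, mul_zero]
      refine ⟨0, -x, 0, ?_⟩
      rw [hfox, hT, hP, mul_zero]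
      simp only [Prod.mk.injEq, true_and, and_true]
      linear_combination hx
    · rintro ⟨α, β, γ, h⟩
      rw [hfox] at h
      have hP : P f = 0 := congrArg Prod.fst h
      refine Prod.ext (mul_left_cancel₀ hd0 ((he f).symm.trans (hP.trans (mul_zero d).symm))) ?_
      refine modForm_eq_zero_iff.2 ⟨-β, ?_⟩
      rw [h]
      ring

end Computation

end Sapphire

theorem mainTheorem4 (r s t u : ℤ)
    (hdet : r * u - s * t = 1 ∨ r * u - s * t = -1)
    (hne : r * s * t * u ≠ 0) :
    -- the action with a₁ ↦ 1, b₁ ↦ 1, a₂ ↦ -1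
    (Nonempty (groupCohomology (twistedInt (Sapphire.eta r s t u 1 (-1))) 1 ≃+ ZMod 2) ∧
      (Even s →
        Nonempty (groupCohomology (twistedInt (Sapphire.eta r s t u 1 (-1))) 2 ≃+
          ZMod (2 * r).natAbs × ZMod 2)) ∧
      (Odd s →
        Nonempty (groupCohomology (twistedInt (Sapphire.eta r s t u 1 (-1))) 2 ≃+
          ZMod (4 * r).natAbs))) ∧
    -- the action with a₁ ↦ -1, b₁ ↦ 1, a₂ ↦ 1
    (Nonempty (groupCohomology (twistedInt (Sapphire.eta r s t u (-1) 1)) 1 ≃+ ZMod 2) ∧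
      (Even s →
        Nonempty (groupCohomology (twistedInt (Sapphire.eta r s t u (-1) 1)) 2 ≃+
          ZMod (2 * u).natAbs × ZMod 2)) ∧
      (Odd s →
        Nonempty (groupCohomology (twistedInt (Sapphire.eta r s t u (-1) 1)) 2 ≃+
          ZMod (4 * u).natAbs))) ∧
    -- the action with a₁ ↦ -1, b₁ ↦ 1, a₂ ↦ -1
    (Nonempty (groupCohomology (twistedInt (Sapphire.eta r s t u (-1) (-1))) 1 ≃+
        ℤ × ZMod 2) ∧
      Nonempty (groupCohomology (twistedInt (Sapphire.eta r s t u (-1) (-1))) 2 ≃+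
        ℤ × ZMod s.natAbs)) := by
  obtain ⟨⟨⟨hr, hs⟩, -⟩, hu⟩ : ((r ≠ 0 ∧ s ≠ 0) ∧ t ≠ 0) ∧ u ≠ 0 := by
    simpa only [mul_ne_zero_iff] using hne
  have hsq : (r * u - s * t) * (r * u - s * t) = 1 := by
    rcases hdet with h | h <;> rw [h] <;> rfl
  have h0 : r * u - s * t ≠ 0 := left_ne_zero_of_mul_eq_one hsq
  exact ⟨⟨Sapphire.nonempty_H1_trivial_neg hr, Sapphire.nonempty_H2_trivial_neg_of_even hr,
      Sapphire.nonempty_H2_trivial_neg_of_odd hr⟩,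
    ⟨Sapphire.nonempty_H1_neg_trivial hu, Sapphire.nonempty_H2_neg_trivial_of_even h0 hu,
      Sapphire.nonempty_H2_neg_trivial_of_odd h0 hu⟩,
    Sapphire.nonempty_H1_neg_neg hs, Sapphire.nonempty_H2_neg_neg hsq hs⟩
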